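/- For subsets $A,B$ of a finite abelian group $G$ (written additively), let $\Delta(A,B)$ be the multiset $\{x-y : x\in A,\ y\in B\}$. A $k$-subset $D$ of a group $G$ of order $v$ is a $(v,k,\lambda)$-difference set, where $\lambda\ge 1$, if $\Delta(D,D)$ consists of $k$ copies of $0$ and $\lambda$ copies of each nonzero element of $G$. Pairwise disjoint subsets $D_1,\dots,D_m$ of an abelian group $G$ of order $v$ with $|D_i|=k_i$ form a $(v,m;k_1,\dots,k_m;\lambda_1,\dots,\lambda_m)$-GSEDF (generalized strong external difference family) in $G$, where the $\lambda_i$ are positive integers, if for every $i$ the multiset union $\bigcup_{j\ne i}\Delta(D_i,D_j)$ (adding multiplicities) consists of exactly $\lambda_i$ copies of each nonzero element of $G$. **Theorem.** Let $q$ and $q+2$ be odd prime powers and $v=q(q+2)$. Then $4\mid v+1$, and a $\left(v,2;\frac{v-1}2,\frac{v+1}2;\frac{v+1}4,\frac{v+1}4\right)$-GSEDF exists. More precisely, for all finite fields $\mathbb F_q$ and $\mathbb F_{q+2}$ of orders $q$ and $q+2$, the twin-prime-power set $$D=\{(x,0): x\in\mathbb F_q\}\cup\{(x,y): x\in\mathbb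 F_q\setminus\{0\},\ y\in\mathbb F_{q+2}\setminus\{0\},\ x\text{ and }y\text{ are both squares or both nonsquares}\}$$ is a $\left(v,\frac{v-1}2,\frac{v-3}4\right)$-difference set in the additive group $G=\mathbb F_q\times\mathbb F_{q+2}$, and $\{D,\,G\setminus D\}$ (in this order) is a $\left(v,2;\frac{v-1}2,\frac{v+1}2;\frac{v+1}4,\frac{v+1}4\right)$-GSEDF in $G$. -/

import Mathlib

/-- The multiset of differences `x - y` with `x ∈ A` and `y ∈ B`, counted with multiplicity. -/
def diffMultiset {G : Type*} [AddCommGroup G] (A B : Finset G) : Multiset G :=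
  (A ×ˢ B).val.map fun p => p.1 - p.2

/-- `D` is a `(v, k, lam)`-difference set in the finite abelian group `G`: `G` has order `v`,
`D` has `k` elements, `lam` is positive, and the multiset of differences of `D` consists of
`k` copies of `0` and `lam` copies of every nonzero element of `G`. -/
def IsDifferenceSet {G : Type*} [AddCommGroup G] [Fintype G] [DecidableEq G]
    (v k lam : ℕ) (D : Finset G) : Prop :=
  Fintype.card G = v ∧ D.card = k ∧ 0 < lam ∧
    diffMultiset D D = k • ({0} : Multiset G) + lam • ((Finset.univ : Finset G) \ {0}).val

/-- The family `D` is a `(v, m; k_1, …, k_m; lam_1, …, lam_m)`-generalized strong external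
difference family in the finite abelian group `G`. Unions of multisets add multiplicities. -/
def IsGSEDF {G : Type*} [AddCommGroup G] [Fintype G] [DecidableEq G]
    (v m : ℕ) (k lam : Fin m → ℕ) (D : Fin m → Finset G) : Prop :=
  Fintype.card G = v ∧
  (∀ i, 0 < lam i) ∧
  (∀ i j, i ≠ j → Disjoint (D i) (D j)) ∧
  (∀ i, (D i).card = k i) ∧
  ∀ i, ∑ j ∈ Finset.univ.filter (fun j => j ≠ i), diffMultiset (D i) (D j) =
    lam i • ((Finset.univ : Finset G) \ {0}).val

/-- The twin-prime-power set in `F × K`, for finite fields `F` and `K` (of orders `q` and `q + 2`):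
all pairs `(x, 0)`, and all pairs `(x, y)` of nonzero elements such that `x` and `y` are both
squares or both nonsquares. -/
def twinPrimePowerSet (F K : Type*) [Field F] [Fintype F] [DecidableEq F]
    [Field K] [Fintype K] [DecidableEq K] : Finset (F × K) :=
  Finset.univ.filter fun z =>
    z.2 = 0 ∨ (z.1 ≠ 0 ∧ z.2 ≠ 0 ∧ (IsSquare z.1 ↔ IsSquare z.2))

/-!
Let `χ` and `ψ` be the quadratic characters of `F` and `K`. The `±1`-valued function of the twin
prime power set is `s = a + t`, where `a(x, y) = χ(x) ψ(y)` and `t` is the difference of the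
indicator functions of `F × {0}` and `{0} × (K \ {0})`. Exactly one of `-1 ∈ F` and `-1 ∈ K` is a
square, so `a` is odd, while `t` is even; hence the cross terms in the autocorrelation of `s`
cancel. The autocorrelations of `χ` and `ψ` are Jacobi sums, and for `|K| = |F| + 2` the
autocorrelations of `a` and `t` add up to `-1` away from the origin. A set whose `±1`-valued
function has this property is a difference set, and the multiset identity
`Δ(D, D) + Δ(D, Dᶜ) = |D| • G` turns a difference set into a two-set GSEDF.
-/

open Finset

section Correlation

variable {G H R : Type*}

/-- The external product `(x, y) ↦ f x * g y` of functions on two sets, representing the pure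
tensor `f ⊗ g`. -/
def externalProduct [Mul R] (f : G → R) (g : H → R) : G × H → R :=
  fun z => f z.1 * g z.2

theorem externalProduct_single_zero_one [Zero G] [Zero H] [DecidableEq G] [DecidableEq H]
    [MulZeroOneClass R] :
    externalProduct (Pi.single (0 : G) (1 : R)) (Pi.single (0 : H) 1) = Pi.single 0 1 := by
  ext ⟨x, y⟩
  simp [externalProduct, Pi.single_apply, ← ite_and, and_comm]

variable [Fintype G] [Fintype H]

theorem sum_externalProduct [NonUnitalNonAssocSemiring R] (f : G → R) (g : H → R) :
    ∑ z, externalProduct f g z = (∑ x, f x) * ∑ y, g y := by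
  simp only [externalProduct, Fintype.sum_prod_type, sum_mul_sum]

/-- The cross-correlation of two functions on a finite group, bundled as a bilinear map. The shift
is chosen such that the correlation of two indicator functions counts differences, as in
`count_diffMultiset_eq_correlation`. -/
def correlation [AddGroup G] [CommSemiring R] : (G → R) →ₗ[R] (G → R) →ₗ[R] (G → R) :=
  LinearMap.mk₂ R (fun f g u => ∑ x, f x * g (x - u))
    (fun f f' g => by ext; simp [add_mul, sum_add_distrib])
    (fun c f g => by ext; simp [mul_assoc, mul_sum])
    (fun f g g' => by ext; simp [mul_add, sum_add_distrib])
    (fun c f g => by ext; simp [mul_left_comm, mul_sum])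

variable [AddGroup G] [AddGroup H] [CommSemiring R]

theorem correlation_apply (f g : G → R) (u : G) :
    correlation f g u = ∑ x, f x * g (x - u) :=
  rfl

theorem correlation_one_left (g : G → R) (u : G) : correlation 1 g u = ∑ x, g x := by
  simpa [correlation_apply] using Equiv.sum_comp (Equiv.subRight u) g

theorem correlation_one_right (f : G → R) (u : G) : correlation f 1 u = ∑ x, f x := by
  simp [correlation_apply]

theorem correlation_single_right [DecidableEq G] (f : G → R) (u : G) :
    correlation f (Pi.single 0 1) u = f u := by
  simp [correlation_apply, Pi.single_apply, sub_eq_zero]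

theorem correlation_externalProduct (f g : G → R) (f' g' : H → R) :
    correlation (externalProduct f f') (externalProduct g g') =
      externalProduct (correlation f g) (correlation f' g') := by
  ext ⟨u, w⟩
  simp only [externalProduct, correlation_apply, Prod.fst_sub, Prod.snd_sub, sum_mul_sum,
    Fintype.sum_prod_type, mul_mul_mul_comm]

theorem correlation_add_self_of_odd_of_even {G R : Type*} [Fintype G] [AddCommGroup G]
    [CommRing R] {f g : G → R} (hf : f.Odd) (hg : g.Even) :
    correlation (f + g) (f + g) = correlation f f + correlation g g := by
  have hswap : correlation f g = -correlation g f := by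
    ext u
    rw [Pi.neg_apply, correlation_apply, correlation_apply, ← Equiv.sum_comp (Equiv.subLeft u),
      ← sum_neg_distrib]
    refine sum_congr rfl fun x _ => ?_
    rw [Equiv.subLeft_apply, sub_sub_cancel_left, ← neg_sub x u, hf, hg]
    ring
  simp only [map_add, LinearMap.add_apply, hswap]
  abel

end Correlation

section Differences

variable {G : Type*} [AddCommGroup G]

theorem count_diffMultiset [DecidableEq G] (A B : Finset G) (g : G) :
    (diffMultiset A B).count g = #{x ∈ A | x - g ∈ B} := by
  rw [diffMultiset, Multiset.count_map, ← filter_val, card_val]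
  refine card_nbij' Prod.fst (fun x => (x, x - g)) ?_ ?_ ?_ ?_ <;> intro x <;> aesop

theorem map_neg_diffMultiset (A B : Finset G) :
    (diffMultiset A B).map Neg.neg = diffMultiset B A := by
  simp only [diffMultiset, product_val, ← Multiset.map_swap_product A.val, Multiset.map_map,
    Function.comp_def, Prod.fst_swap, Prod.snd_swap, neg_sub]

variable [Fintype G] [DecidableEq G]

theorem diffMultiset_add_diffMultiset_compl (A B : Finset G) :
    diffMultiset A B + diffMultiset A Bᶜ = #A • (univ : Finset G).val := by
  ext g
  simp only [Multiset.count_add, count_diffMultiset, mem_compl, card_filter_add_card_filter_not,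
    Multiset.count_nsmul, Multiset.count_univ, mul_one]

theorem singleton_zero_add_univ_sdiff_val :
    ({0} : Multiset G) + ((univ : Finset G) \ {0}).val = (univ : Finset G).val := by
  rw [sdiff_val, singleton_val, add_tsub_cancel_of_le]
  exact Multiset.singleton_le.2 (mem_univ 0)

theorem map_neg_univ_sdiff_zero_val :
    ((univ : Finset G) \ {0}).val.map Neg.neg = ((univ : Finset G) \ {0}).val :=
  congrArg Finset.val
    (show (univ \ {0}).map (Equiv.neg G).toEmbedding = univ \ {0} by ext; simp)

theorem isGSEDF_pair_iff {v : ℕ} {k lam : Fin 2 → ℕ} {A B : Finset G} :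
    IsGSEDF v 2 k lam ![A, B] ↔
      Fintype.card G = v ∧ (0 < lam 0 ∧ 0 < lam 1) ∧ Disjoint A B ∧ (#A = k 0 ∧ #B = k 1) ∧
        diffMultiset A B = lam 0 • ((univ : Finset G) \ {0}).val ∧
        diffMultiset B A = lam 1 • ((univ : Finset G) \ {0}).val := by
  have others_zero : ({j | j ≠ 0} : Finset (Fin 2)) = {1} := by decide
  have others_one : ({j | j ≠ 1} : Finset (Fin 2)) = {0} := by decide
  simp [IsGSEDF, Fin.forall_fin_two, others_zero, others_one, disjoint_comm (a := B), -sdiff_val]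

theorem IsDifferenceSet.diffMultiset_compl {v k lam : ℕ} {D : Finset G}
    (hD : IsDifferenceSet v k lam D) (hlam : lam ≤ k) :
    diffMultiset D Dᶜ = (k - lam) • ((univ : Finset G) \ {0}).val := by
  obtain ⟨-, hk, -, hdiff⟩ := hD
  have hsum := diffMultiset_add_diffMultiset_compl D D
  rw [hdiff, hk, ← singleton_zero_add_univ_sdiff_val, nsmul_add, add_assoc] at hsum
  refine add_left_cancel ((add_left_cancel hsum).trans ?_)
  rw [← add_nsmul, Nat.add_sub_cancel' hlam]

theorem IsDifferenceSet.isGSEDF_compl {v k lam : ℕ} {D : Finset G}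
    (hD : IsDifferenceSet v k lam D) (hlam : lam < k) :
    IsGSEDF v 2 ![k, v - k] ![k - lam, k - lam] ![D, Dᶜ] := by
  have hdiff := hD.diffMultiset_compl hlam.le
  have hdiff' : diffMultiset Dᶜ D = (k - lam) • ((univ : Finset G) \ {0}).val := by
    rw [← map_neg_diffMultiset, hdiff, Multiset.map_nsmul, map_neg_univ_sdiff_zero_val]
  obtain ⟨hv, hk, -, -⟩ := hD
  have hpos : 0 < k - lam := Nat.sub_pos_of_lt hlam
  exact isGSEDF_pair_iff.2 ⟨hv, ⟨hpos, hpos⟩, disjoint_compl_right,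
    ⟨hk, by rw [card_compl, hv, hk]; rfl⟩, hdiff, hdiff'⟩

theorem isDifferenceSet_iff_count {v k lam : ℕ} {D : Finset G} :
    IsDifferenceSet v k lam D ↔ Fintype.card G = v ∧ #D = k ∧ 0 < lam ∧
      ∀ g ≠ 0, (diffMultiset D D).count g = lam := by
  have hcount_rhs (g : G) :
      (k • ({0} : Multiset G) + lam • ((univ : Finset G) \ {0}).val).count g =
        if g = 0 then k else lam := by
    have hnodup := Multiset.count_eq_of_nodup (a := g) (univ \ {0} : Finset G).nodup
    split_ifs with hg <;> simp_all [-sdiff_val]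
  refine and_congr_right fun _ => and_congr_right fun hk => and_congr_right fun _ => ?_
  simp only [Multiset.ext, hcount_rhs]
  refine forall_congr' fun g => ?_
  by_cases hg : g = 0
  · simp [hg, count_diffMultiset, hk]
  · simp [hg]

end Differences

section SignFunction

variable {G : Type*}

theorem sum_indicator_one {R : Type*} [NonAssocSemiring R] [Fintype G] (D : Finset G) :
    ∑ z, (D : Set G).indicator (1 : G → R) z = #D := by
  simp [sum_indicator_subset _ (subset_univ D)]

variable [DecidableEq G]

/-- The `±1`-valued function of a set `D`, equal to `1` on `D` and to `-1` off `D`. Its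
autocorrelation determines whether `D` is a difference set. -/
def signFunction (D : Finset G) : G → ℤ :=
  fun z => if z ∈ D then 1 else -1

theorem signFunction_eq_two_smul_indicator_sub_one (D : Finset G) :
    signFunction D = (2 : ℤ) • (D : Set G).indicator 1 - 1 := by
  ext z
  by_cases hz : z ∈ D <;> simp [signFunction, hz]

variable [Fintype G]

theorem sum_signFunction (D : Finset G) : ∑ z, signFunction D z = 2 * #D - Fintype.card G := by
  simp [signFunction_eq_two_smul_indicator_sub_one, sum_sub_distrib, ← mul_sum, sum_indicator_one]

variable [AddCommGroup G]

theorem count_diffMultiset_eq_correlation {R : Type*} [CommSemiring R] (A B : Finset G) (g : G) :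
    ((diffMultiset A B).count g : R) =
      correlation ((A : Set G).indicator 1) ((B : Set G).indicator 1) g := by
  simp only [count_diffMultiset, correlation_apply, Set.indicator_apply, mem_coe, Pi.one_apply,
    ite_zero_mul_ite_zero, mul_one, sum_boole, filter_and, filter_univ_mem, inter_filter,
    inter_univ]

theorem correlation_signFunction (D : Finset G) (g : G) :
    correlation (signFunction D) (signFunction D) g =
      4 * (diffMultiset D D).count g - 4 * #D + Fintype.card G := by
  simp only [signFunction_eq_two_smul_indicator_sub_one, map_sub, map_smul, LinearMap.sub_apply,
    LinearMap.smul_apply, Pi.sub_apply, Pi.smul_apply, correlation_one_left, correlation_one_right,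
    ← count_diffMultiset_eq_correlation, sum_indicator_one, smul_eq_mul, Pi.one_apply, sum_const,
    card_univ, nsmul_eq_mul]
  ring

theorem isDifferenceSet_of_correlation_signFunction_eq_neg_one {lam : ℕ} {D : Finset G}
    (hlam : 0 < lam) (hG : Fintype.card G = 4 * lam + 3) (hsum : ∑ z, signFunction D z = -1)
    (hcorr : ∀ g ≠ 0, correlation (signFunction D) (signFunction D) g = -1) :
    IsDifferenceSet (4 * lam + 3) (2 * lam + 1) lam D := by
  rw [sum_signFunction, hG] at hsum
  have hk : #D = 2 * lam + 1 := by omega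
  refine isDifferenceSet_iff_count.2 ⟨hG, hk, hlam, fun g hg => ?_⟩
  have hg_corr := hcorr g hg
  rw [correlation_signFunction, hG, hk] at hg_corr
  omega

end SignFunction

section Characters

variable {F : Type*} [Field F] [Fintype F]

theorem correlation_mulChar_inv_of_ne_zero {R : Type*} [CommRing R] [IsDomain R]
    {χ : MulChar F R} (hχ : χ ≠ 1) {u : F} (hu : u ≠ 0) : correlation χ ⇑χ⁻¹ u = -1 := by
  have hunit {c : F} (hc : c ≠ 0) : χ c * χ⁻¹ c = 1 := by
    rw [← MulChar.mul_apply, mul_inv_cancel, MulChar.one_apply hc.isUnit]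
  calc correlation χ ⇑χ⁻¹ u = ∑ x, χ (u * x) * χ⁻¹ (u * x - u) :=
        (Equiv.sum_comp (Equiv.mulLeft₀ u hu) fun x => χ x * χ⁻¹ (x - u)).symm
    _ = ∑ x, χ⁻¹ (-1) * (χ x * χ⁻¹ (1 - x)) := by
        refine sum_congr rfl fun x _ => ?_
        rw [show u * x - u = u * (-1 * (1 - x)) by ring]
        simp only [map_mul]
        linear_combination (χ⁻¹ (-1) * (χ x * χ⁻¹ (1 - x))) * hunit hu
    _ = χ⁻¹ (-1) * -χ (-1) := by rw [← mul_sum, ← jacobiSum, jacobiSum_nontrivial_inv hχ]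
    _ = -1 := by linear_combination -hunit (neg_ne_zero.2 one_ne_zero)

theorem correlation_mulChar_inv [DecidableEq F] {R : Type*} [CommRing R] [IsDomain R]
    {χ : MulChar F R} (hχ : χ ≠ 1) :
    correlation χ ⇑χ⁻¹ = (Fintype.card F : R) • Pi.single 0 1 - 1 := by
  ext u
  rcases eq_or_ne u 0 with rfl | hu
  · simp only [correlation_apply, sub_zero, ← MulChar.mul_apply, mul_inv_cancel,
      MulChar.sum_one_eq_card_units, Fintype.card_eq_card_units_add_one (α := F),
      Nat.cast_add, Nat.cast_one, Pi.sub_apply, Pi.smul_apply, Pi.single_eq_same, smul_eq_mul,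
      mul_one, Pi.one_apply, add_sub_cancel_right]
  · simp [correlation_mulChar_inv_of_ne_zero hχ hu, hu]

theorem ringChar_ne_two_of_odd_card (hF : Odd (Fintype.card F)) : ringChar F ≠ 2 := fun hchar =>
  Nat.not_even_iff_odd.2 hF (Nat.even_iff.2 (FiniteField.even_card_of_char_two hchar))

theorem ringChar_ne_two_of_card_eq_card_add_two {K : Type*} [Field K] [Fintype K]
    (hF : ringChar F ≠ 2) (hcard : Fintype.card K = Fintype.card F + 2) : ringChar K ≠ 2 := by
  refine ringChar_ne_two_of_odd_card (hcard ▸ Odd.add_even ?_ even_two)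
  exact Nat.odd_iff.2 (FiniteField.odd_card_of_char_ne_two hF)

variable [DecidableEq F] {K : Type*} [Field K] [Fintype K] [DecidableEq K]

theorem correlation_quadraticChar (hF : ringChar F ≠ 2) :
    correlation (quadraticChar F) (quadraticChar F) =
      (Fintype.card F : ℤ) • Pi.single 0 1 - 1 := by
  simpa only [(quadraticChar_isQuadratic F).inv] using
    correlation_mulChar_inv (quadraticChar_ne_one hF)

theorem quadraticChar_neg_one_mul_quadraticChar_neg_one (hF : ringChar F ≠ 2)
    (hcard : Fintype.card K = Fintype.card F + 2) :
    quadraticChar F (-1) * quadraticChar K (-1) = -1 := by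
  have hF_odd := FiniteField.odd_card_of_char_ne_two hF
  rw [quadraticChar_neg_one hF,
    quadraticChar_neg_one (ringChar_ne_two_of_card_eq_card_add_two hF hcard), hcard,
    ZMod.χ₄_eq_neg_one_pow hF_odd, ZMod.χ₄_eq_neg_one_pow (by omega),
    Nat.add_div_right _ two_pos, pow_succ, ← mul_assoc, ← mul_pow]
  norm_num

theorem odd_externalProduct_quadraticChar (hF : ringChar F ≠ 2)
    (hcard : Fintype.card K = Fintype.card F + 2) :
    (externalProduct (quadraticChar F) (quadraticChar K)).Odd := by
  rintro ⟨x, y⟩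
  have hneg := quadraticChar_neg_one_mul_quadraticChar_neg_one hF hcard
  simp only [externalProduct, Prod.neg_mk]
  rw [← neg_one_mul x, ← neg_one_mul y, map_mul, map_mul]
  linear_combination (quadraticChar F x * quadraticChar K y) * hneg

end Characters

section AxesSign

variable (G H : Type*) [DecidableEq G] [DecidableEq H]

/-- The indicator function of `G × {0}` minus that of `{0} × (H \ {0})`. For `G = F` and `H = K`
this is the even part of the `±1`-valued function of the twin prime power set. -/
def axesSign [Zero G] [Zero H] : G × H → ℤ :=
  externalProduct 1 (Pi.single 0 1) - externalProduct (Pi.single 0 1) (1 - Pi.single 0 1)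

variable {G H} [AddGroup G] [AddGroup H]

theorem even_axesSign : (axesSign G H).Even := by
  rintro ⟨x, y⟩
  simp [axesSign, externalProduct, Pi.single_apply]

variable [Fintype G] [Fintype H]

theorem sum_axesSign : ∑ z, axesSign G H z = Fintype.card G - Fintype.card H + 1 := by
  simp only [axesSign, Pi.sub_apply, sum_sub_distrib, sum_externalProduct, Pi.one_apply, sum_const,
    card_univ, Int.nsmul_eq_mul, sum_pi_single', mem_univ, if_true]
  ring

theorem correlation_axesSign :
    correlation (axesSign G H) (axesSign G H) =
      externalProduct 1 ((Fintype.card G + 2 : ℤ) • Pi.single 0 1 - 2) +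
        externalProduct (Pi.single 0 1) (Pi.single 0 1 + (Fintype.card H - 2 : ℤ) • 1) := by
  ext ⟨u, w⟩
  simp only [axesSign, map_sub, LinearMap.sub_apply, correlation_externalProduct, externalProduct,
    correlation_one_right, correlation_single_right, Pi.sub_apply, Pi.add_apply, Pi.smul_apply,
    Pi.ofNat_apply, smul_eq_mul, sum_const, card_univ, Int.nsmul_eq_mul, sum_pi_single', mem_univ,
    if_true]
  ring

end AxesSign

section TwinPrimePower

variable {F K : Type*} [Field F] [Fintype F] [DecidableEq F] [Field K] [Fintype K] [DecidableEq K]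

theorem signFunction_twinPrimePowerSet :
    signFunction (twinPrimePowerSet F K) =
      externalProduct (quadraticChar F) (quadraticChar K) + axesSign F K := by
  ext ⟨x, y⟩
  simp only [signFunction, axesSign, twinPrimePowerSet, externalProduct, mem_filter, mem_univ,
    true_and, Pi.add_apply, Pi.sub_apply, Pi.one_apply, Pi.single_apply, quadraticChar_apply,
    quadraticCharFun]
  by_cases hx : x = 0 <;> by_cases hy : y = 0 <;> by_cases hx_sq : IsSquare x <;>
    by_cases hy_sq : IsSquare y <;> simp_all

theorem sum_signFunction_twinPrimePowerSet (hF : ringChar F ≠ 2)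
    (hcard : Fintype.card K = Fintype.card F + 2) :
    ∑ z, signFunction (twinPrimePowerSet F K) z = -1 := by
  simp only [signFunction_twinPrimePowerSet, Pi.add_apply, sum_add_distrib, sum_externalProduct,
    quadraticChar_sum_zero hF, sum_axesSign, hcard]
  push_cast
  ring

theorem correlation_signFunction_twinPrimePowerSet (hF : ringChar F ≠ 2)
    (hcard : Fintype.card K = Fintype.card F + 2) :
    correlation (signFunction (twinPrimePowerSet F K)) (signFunction (twinPrimePowerSet F K)) =
      (Fintype.card (F × K) + 1 : ℤ) • Pi.single 0 1 - 1 := by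
  have hK := ringChar_ne_two_of_card_eq_card_add_two hF hcard
  rw [signFunction_twinPrimePowerSet, correlation_add_self_of_odd_of_even
      (odd_externalProduct_quadraticChar hF hcard) even_axesSign,
    correlation_externalProduct, correlation_quadraticChar hF, correlation_quadraticChar hK,
    correlation_axesSign, ← externalProduct_single_zero_one]
  ext ⟨u, w⟩
  simp only [externalProduct, Fintype.card_prod, hcard, Nat.cast_mul, Nat.cast_add, Nat.cast_ofNat,
    Pi.add_apply, Pi.sub_apply, Pi.smul_apply, Pi.ofNat_apply, smul_eq_mul]
  ring

theorem isDifferenceSet_twinPrimePowerSet {lam : ℕ} (hF : ringChar F ≠ 2)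
    (hcard : Fintype.card K = Fintype.card F + 2) (hlam : Fintype.card (F × K) = 4 * lam + 3) :
    IsDifferenceSet (4 * lam + 3) (2 * lam + 1) lam (twinPrimePowerSet F K) := by
  have hlam_pos : 0 < lam := by
    have hF_card := Fintype.one_lt_card (α := F)
    rw [Fintype.card_prod, hcard] at hlam
    nlinarith
  refine isDifferenceSet_of_correlation_signFunction_eq_neg_one hlam_pos hlam
    (sum_signFunction_twinPrimePowerSet hF hcard) fun g hg => ?_
  simp [correlation_signFunction_twinPrimePowerSet hF hcard, hg]

theorem isGSEDF_twinPrimePowerSet {lam : ℕ} (hF : ringChar F ≠ 2)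
    (hcard : Fintype.card K = Fintype.card F + 2) (hlam : Fintype.card (F × K) = 4 * lam + 3) :
    IsGSEDF (4 * lam + 3) 2 ![2 * lam + 1, 2 * lam + 2] ![lam + 1, lam + 1]
      ![twinPrimePowerSet F K, (twinPrimePowerSet F K)ᶜ] := by
  have hcompl := (isDifferenceSet_twinPrimePowerSet hF hcard hlam).isGSEDF_compl (by omega)
  rwa [show 4 * lam + 3 - (2 * lam + 1) = 2 * lam + 2 by omega,
    show 2 * lam + 1 - lam = lam + 1 by omega] at hcompl

end TwinPrimePower

theorem exists_field_card_eq {q : ℕ} (hq : IsPrimePow q) :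
    ∃ (F : Type) (_ : Field F) (_ : Fintype F) (_ : DecidableEq F), Fintype.card F = q :=
  ⟨Fin q, (Fintype.nonempty_field_iff.2 (by rwa [Fintype.card_fin])).some, inferInstance,
    inferInstance, Fintype.card_fin q⟩

theorem exists_mul_add_two_eq_four_mul_add_three {q : ℕ} (hq : Odd q) :
    ∃ lam, q * (q + 2) = 4 * lam + 3 := by
  obtain ⟨m, rfl⟩ := hq
  exact ⟨m * (m + 2), by ring⟩

theorem mainTheorem8 (q v : ℕ) (hq : IsPrimePow q) (hq_odd : Odd q)
    (hq2 : IsPrimePow (q + 2)) (hv : v = q * (q + 2)) :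
    4 ∣ v + 1 ∧
    (∃ (G : Type) (_ : AddCommGroup G) (_ : Fintype G) (_ : DecidableEq G)
        (D : Fin 2 → Finset G),
      IsGSEDF v 2 ![(v - 1) / 2, (v + 1) / 2] ![(v + 1) / 4, (v + 1) / 4] D) ∧
    (∀ (F K : Type*) [Field F] [Fintype F] [DecidableEq F]
        [Field K] [Fintype K] [DecidableEq K],
      Fintype.card F = q → Fintype.card K = q + 2 →
      IsDifferenceSet v ((v - 1) / 2) ((v - 3) / 4) (twinPrimePowerSet F K) ∧
      IsGSEDF v 2 ![(v - 1) / 2, (v + 1) / 2] ![(v + 1) / 4, (v + 1) / 4]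
        ![twinPrimePowerSet F K, (twinPrimePowerSet F K)ᶜ]) := by
  obtain ⟨lam, hlam⟩ := exists_mul_add_two_eq_four_mul_add_three hq_odd
  obtain rfl : v = 4 * lam + 3 := hv.trans hlam
  have hk : (4 * lam + 3 - 1) / 2 = 2 * lam + 1 := by omega
  have hk_compl : (4 * lam + 3 + 1) / 2 = 2 * lam + 2 := by omega
  have hlam_diff : (4 * lam + 3 - 3) / 4 = lam := by omega
  have hlam_ext : (4 * lam + 3 + 1) / 4 = lam + 1 := by omega
  rw [hk, hk_compl, hlam_diff, hlam_ext]
  refine ⟨by omega, ?_, ?_⟩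
  · obtain ⟨F, _, _, _, hF⟩ := exists_field_card_eq hq
    obtain ⟨K, _, _, _, hK⟩ := exists_field_card_eq hq2
    exact ⟨F × K, inferInstance, inferInstance, inferInstance, _, isGSEDF_twinPrimePowerSet
      (ringChar_ne_two_of_odd_card (hF ▸ hq_odd)) (by rw [hK, hF])
      (by rw [Fintype.card_prod, hF, hK, hlam])⟩
  · intro F K _ _ _ _ _ _ hF hK
    have hF_char : ringChar F ≠ 2 := ringChar_ne_two_of_odd_card (hF ▸ hq_odd)
    have hcard : Fintype.card K = Fintype.card F + 2 := by rw [hK, hF]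
    have hG : Fintype.card (F × K) = 4 * lam + 3 := by rw [Fintype.card_prod, hF, hK, hlam]
    exact ⟨isDifferenceSet_twinPrimePowerSet hF_char hcard hG,
      isGSEDF_twinPrimePowerSet hF_char hcard hG⟩
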